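/- Let $n\in\mathbb N$, $A\in\mathbb R^{n\times n}$, $0\neq B\in\mathbb R^{n\times 1}$, $C\in\mathbb R^{1\times n}$. For $K\in\mathbb R$ put $A_K=A-BKC$ and consider the system $$\dot e=A_Ke+B\xi,\qquad \varepsilon=Ce,$$ with scalar input $\xi$ and scalar output $\varepsilon$. Let $W(\lambda)=C(\lambda I-A)^{-1}B=b(\lambda)/a(\lambda)$, where $a(\lambda)=\det(\lambda I-A)$ and $b$ is a polynomial of degree at most $n-1$. Call $W$ hyper-minimum-phase (HMP) if $b$ is a Hurwitz polynomial (all its complex roots have negative real part) of degree $n-1$ with positive coefficients. For a symmetric matrix $P$ let $V(e)=e^{T}Pe$ and let $\dot V(e,\xi)$ be its derivative along the system, i.e. the derivative of $V$ at $e$ in the direction $A_Ke+B\xi$. For symmetric matrices, $X<Y$ means that $Y-X$ is positive definite. 1. The following are equivalent: (a) there exist a symmetric positive definite $P$ and a number $K$ such that $\dot V(e,\xi)<0$ for all $e\neq0$ and all $\xi\in\mathbb R$ satisfying the sector condition $\xi\,Ce\le 0$; (b) $W$ is HMP. 2. If $W$ is HMP, then there are a symmetric positive definite $P$ and numbers $K_0$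 and $\mu_0>0$ such that for every $K\ge K_0$ one has $PA_K+A_K^{T}P<0$ and $PB=C^{T}$, and for every $K\ge K_0$ and every $0<\mu\le\mu_0$ one has $PA_K+A_K^{T}P<-\mu P$ and $\dot V(e,\xi)<-\mu V(e)$ for all $e\ne0$ and all $\xi$ with $\xi\,Ce\le0$. 3. For every symmetric positive definite $P$ and every $K$ with $PA_K+A_K^{T}P<0$ and $PB=C^{T}$ there is $\mu_0>0$ such that $PA_K+A_K^{T}P<-\mu P$ for all $0<\mu\le\mu_0$. -/

import Mathlib

open Matrix Polynomial

noncomputable section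

/-- The transfer function `W(λ) = C (λ I - A)⁻¹ B` of the single-input single-output system
`ė = A e + B ξ`, `ε = C e`, as an element of the field `ℝ(λ)` of real rational functions.
The column `B` and the row `C` are both given by their entries. -/
def transferFunction {n : ℕ} (A : Matrix (Fin n) (Fin n) ℝ) (B C : Fin n → ℝ) : RatFunc ℝ :=
  (fun i => RatFunc.C (C i)) ⬝ᵥ
    ((Matrix.scalar (Fin n) (RatFunc.X : RatFunc ℝ) - A.map (RatFunc.C : ℝ →+* RatFunc ℝ))⁻¹ *ᵥ
      fun i => RatFunc.C (B i))

/-- A real polynomial is Hurwitz if all its complex roots have negative real part. -/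
def IsHurwitzPoly (b : ℝ[X]) : Prop :=
  ∀ z : ℂ, Polynomial.aeval z b = 0 → z.re < 0

/-- The system `(A, B, C)` of order `n` is hyper-minimum-phase: writing its transfer function as
`W = b / a` with `a(λ) = det (λ I - A)`, a polynomial of degree `n`, the numerator `b` is a Hurwitz
polynomial of degree `n - 1` with positive coefficients. (`b` is determined by `W` and `a`.) -/
def IsHMP {n : ℕ} (A : Matrix (Fin n) (Fin n) ℝ) (B C : Fin n → ℝ) : Prop :=
  ∃ b : ℝ[X],
    transferFunction A B C =
      algebraMap ℝ[X] (RatFunc ℝ) b / algebraMap ℝ[X] (RatFunc ℝ) A.charpoly ∧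
    b.natDegree + 1 = n ∧ (∀ i ≤ b.natDegree, 0 < b.coeff i) ∧ IsHurwitzPoly b

/-- The closed-loop matrix `A_K = A - B K C`. -/
def closedLoop {n : ℕ} (A : Matrix (Fin n) (Fin n) ℝ) (B C : Fin n → ℝ) (K : ℝ) :
    Matrix (Fin n) (Fin n) ℝ :=
  A - K • Matrix.vecMulVec B C

/-- The quadratic form `V(e) = eᵀ P e`. -/
def quadForm {n : ℕ} (P : Matrix (Fin n) (Fin n) ℝ) (e : Fin n → ℝ) : ℝ :=
  e ⬝ᵥ (P *ᵥ e)

/-- The time derivative of `V(e) = eᵀ P e` along `ė = A_K e + B ξ`, at the state `e` and the input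
value `ξ`: the derivative of `V` at `e` in the direction `A_K e + B ξ`. -/
def lyapunovDeriv {n : ℕ} (A : Matrix (Fin n) (Fin n) ℝ) (B C : Fin n → ℝ) (K : ℝ)
    (P : Matrix (Fin n) (Fin n) ℝ) (e : Fin n → ℝ) (ξ : ℝ) : ℝ :=
  fderiv ℝ (quadForm P) e (closedLoop A B C K *ᵥ e + ξ • B)

/-- The relations `P A_K + A_Kᵀ P < -μ P` and `P B = Cᵀ` (with `X < Y` meaning that `Y - X` is
symmetric positive definite). -/
def PassifyingRel {n : ℕ} (A : Matrix (Fin n) (Fin n) ℝ) (B C : Fin n → ℝ) (K μ : ℝ)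
    (P : Matrix (Fin n) (Fin n) ℝ) : Prop :=
  (-(μ • P) - (P * closedLoop A B C K + (closedLoop A B C K)ᵀ * P)).PosDef ∧ P *ᵥ B = C

end

/-!
For symmetric `P` the derivative of `V` along the system is `eᵀ (P A_K + A_Kᵀ P) e + 2 ξ eᵀ P B`.
Letting `ξ` range over the sector shows that `V` decreases for all inputs in the sector exactly
when, up to rescaling `P`, the relations `P A_K + A_Kᵀ P < 0` and `P B = Cᵀ` hold
(`exists_passifyingRel_of_sector`, `PassifyingRel.lyapunovDeriv_lt`). The rest compares these
relations with the zeros of the transfer function `W = b / a`.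

The feedback `ξ = -K ε` is a rank-one perturbation of `A`, so the matrix determinant lemma gives
`det (λ I - A_K) = a + K b`. In particular `b = det (λ I - A_1) - a`, which has degree less than `n`
and the coefficient `C B` at `λ ^ (n - 1)`, and a complex number `z` is a zero of `b` as soon as
`(z - A) x` is a multiple of `B` for some `x ≠ 0` with `C x = 0`; conversely every zero `z` for
which some `z - A_K` is invertible is of this form.

If the relations hold, then `C B = Bᵀ P B > 0`. For `x` as above, `x* P B` vanishes, and the
Lyapunov inequality, evaluated at `x`, gives `Re z < 0`; it also makes `A_K` stable, which covers the
remaining zeros (`re_neg_of_lyapunov`). A Hurwitz polynomial with positive leading coefficient has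
positive coefficients (`IsHurwitzPoly.coeff_pos`), so `W` is hyper-minimum-phase.

Conversely, let `W` be hyper-minimum-phase, so that `C B > 0`, and let `Π` be the projection onto
`ker C` along `B`. The zeros of `b` govern the dynamics `Π A` on `ker C`, and Lyapunov's theorem
(`exists_posDef_lyapunov`) yields a quadratic form `H` decreasing there. Then
`P = Πᵀ H Π + Cᵀ C / (C B)` satisfies `P B = Cᵀ`, and `P A + Aᵀ P` is negative definite on `ker C`.
Since `P A_K + A_Kᵀ P = P A + Aᵀ P - 2 K Cᵀ C`, Finsler's lemma
(`exists_forall_posDef_add_smul`) makes it negative definite for large `K`. The same lemma provides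
the margin `μ₀`, and monotonicity in `K` makes it uniform in the gain.
-/

noncomputable section

/-! ### Rank-one perturbations and the numerator of the transfer function -/

section RankOne

variable {ι R : Type*} [Fintype ι] [DecidableEq ι] [CommRing R]

theorem det_one_add_vecMulVec (u v : ι → R) : (1 + vecMulVec u v).det = 1 + v ⬝ᵥ u := by
  rw [vecMulVec_eq Unit, det_one_add_replicateCol_mul_replicateRow]

theorem det_add_vecMulVec {M : Matrix ι ι R} (hM : IsUnit M.det) (u v : ι → R) :
    (M + vecMulVec u v).det = M.det * (1 + v ⬝ᵥ (M⁻¹ *ᵥ u)) := by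
  have h : M + vecMulVec u v = M * (1 + vecMulVec (M⁻¹ *ᵥ u) v) := by
    rw [Matrix.mul_add, Matrix.mul_one, mul_vecMulVec, mulVec_mulVec, mul_nonsing_inv M hM,
      one_mulVec]
  rw [h, det_mul, det_one_add_vecMulVec]

end RankOne

section Numerator

variable {n : ℕ}

/-- The numerator of the transfer function over the denominator `det (λ I - A)`. As the output
feedback `ξ = -ε` is a rank-one perturbation of `A`, it is the change that this feedback makes
to the characteristic polynomial. -/
def transferNumerator (A : Matrix (Fin n) (Fin n) ℝ) (B C : Fin n → ℝ) : ℝ[X] :=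
  (closedLoop A B C 1).charpoly - A.charpoly

theorem algebraMap_charpoly (M : Matrix (Fin n) (Fin n) ℝ) :
    algebraMap ℝ[X] (RatFunc ℝ) M.charpoly =
      (Matrix.scalar (Fin n) (RatFunc.X : RatFunc ℝ) - M.map (RatFunc.C : ℝ →+* RatFunc ℝ)).det := by
  rw [Matrix.charpoly, RingHom.map_det]
  congr 1
  ext i j
  by_cases h : i = j
  · subst h; simp
  · simp [h]

theorem algebraMap_charpoly_ne_zero (M : Matrix (Fin n) (Fin n) ℝ) :
    algebraMap ℝ[X] (RatFunc ℝ) M.charpoly ≠ 0 := by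
  simpa using (Matrix.charpoly_monic M).ne_zero

theorem algebraMap_charpoly_closedLoop (A : Matrix (Fin n) (Fin n) ℝ) (B C : Fin n → ℝ) (K : ℝ) :
    algebraMap ℝ[X] (RatFunc ℝ) (closedLoop A B C K).charpoly =
      algebraMap ℝ[X] (RatFunc ℝ) A.charpoly * (1 + RatFunc.C K * transferFunction A B C) := by
  have hdet : IsUnit (Matrix.scalar (Fin n) (RatFunc.X : RatFunc ℝ) -
      A.map (RatFunc.C : ℝ →+* RatFunc ℝ)).det := by
    rw [← algebraMap_charpoly]
    exact (algebraMap_charpoly_ne_zero A).isUnit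
  have h := det_add_vecMulVec hdet (RatFunc.C K • fun i => RatFunc.C (B i))
    (fun i => RatFunc.C (C i))
  rw [mulVec_smul, dotProduct_smul, ← algebraMap_charpoly, smul_eq_mul] at h
  rw [transferFunction, ← h, algebraMap_charpoly]
  congr 1
  ext i j
  simp [closedLoop, vecMulVec_apply]
  ring

theorem transferFunction_eq (A : Matrix (Fin n) (Fin n) ℝ) (B C : Fin n → ℝ) :
    transferFunction A B C = algebraMap ℝ[X] (RatFunc ℝ) (transferNumerator A B C) /
      algebraMap ℝ[X] (RatFunc ℝ) A.charpoly := by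
  rw [eq_div_iff (algebraMap_charpoly_ne_zero A), transferNumerator, map_sub,
    algebraMap_charpoly_closedLoop, map_one]
  ring

theorem charpoly_closedLoop (A : Matrix (Fin n) (Fin n) ℝ) (B C : Fin n → ℝ) (K : ℝ) :
    (closedLoop A B C K).charpoly =
      A.charpoly + Polynomial.C K * transferNumerator A B C := by
  apply RatFunc.algebraMap_injective ℝ
  have h := algebraMap_charpoly_ne_zero A
  rw [algebraMap_charpoly_closedLoop, transferFunction_eq, map_add, map_mul,
    RatFunc.algebraMap_C]
  field_simp

theorem isHMP_iff (A : Matrix (Fin n) (Fin n) ℝ) (B C : Fin n → ℝ) :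
    IsHMP A B C ↔ (transferNumerator A B C).natDegree + 1 = n ∧
      (∀ i ≤ (transferNumerator A B C).natDegree, 0 < (transferNumerator A B C).coeff i) ∧
      IsHurwitzPoly (transferNumerator A B C) := by
  constructor
  · rintro ⟨b, hb, h⟩
    rw [transferFunction_eq, div_left_inj' (algebraMap_charpoly_ne_zero A)] at hb
    rwa [RatFunc.algebraMap_injective ℝ hb]
  · exact fun h => ⟨_, transferFunction_eq A B C, h⟩

theorem degree_transferNumerator_lt (A : Matrix (Fin n) (Fin n) ℝ) (B C : Fin n → ℝ) :
    (transferNumerator A B C).degree < n := by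
  have h := degree_sub_lt_left (p := (closedLoop A B C 1).charpoly) (q := A.charpoly)
    (by rw [charpoly_degree_eq_dim, charpoly_degree_eq_dim]) (charpoly_monic _).ne_zero
    (by rw [(charpoly_monic _).leadingCoeff, (charpoly_monic _).leadingCoeff])
  rwa [charpoly_degree_eq_dim, Fintype.card_fin] at h

/-- The coefficient of index `n - 1` of a characteristic polynomial is minus the trace. -/
theorem coeff_transferNumerator (A : Matrix (Fin n) (Fin n) ℝ) (B C : Fin n → ℝ) (hn : 0 < n) :
    (transferNumerator A B C).coeff (n - 1) = C ⬝ᵥ B := by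
  have : Nonempty (Fin n) := ⟨⟨0, hn⟩⟩
  have h₁ := trace_eq_neg_charpoly_coeff A
  have h₂ := trace_eq_neg_charpoly_coeff (closedLoop A B C 1)
  rw [Fintype.card_fin] at h₁ h₂
  rw [closedLoop, trace_sub, one_smul, trace_vecMulVec] at h₂
  rw [transferNumerator, coeff_sub, closedLoop, one_smul]
  rw [dotProduct_comm]
  linarith

theorem natDegree_transferNumerator (A : Matrix (Fin n) (Fin n) ℝ) (B C : Fin n → ℝ) (hn : 0 < n)
    (h : C ⬝ᵥ B ≠ 0) : (transferNumerator A B C).natDegree + 1 = n := by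
  have h₁ : n - 1 ≤ (transferNumerator A B C).natDegree :=
    le_natDegree_of_ne_zero (by rwa [coeff_transferNumerator A B C hn])
  have h₂ : (transferNumerator A B C).natDegree < n :=
    (natDegree_lt_iff_degree_lt (by
      rintro h0
      exact h (by rw [← coeff_transferNumerator A B C hn, h0, coeff_zero]))).2
      (degree_transferNumerator_lt A B C)
  omega

theorem aeval_charpoly (M : Matrix (Fin n) (Fin n) ℝ) (z : ℂ) :
    aeval z M.charpoly = (Matrix.scalar (Fin n) z - M.map Complex.ofRealHom).det := by
  rw [← eval_charpoly, ← Polynomial.eval_map_algebraMap, charpoly_map]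
  rfl

/-- If `(z - A) x` is a multiple of `B` for some `x ≠ 0` with `C x = 0`, then `z` is a zero of the
transfer function. -/
theorem aeval_transferNumerator_eq_zero (A : Matrix (Fin n) (Fin n) ℝ) (B C : Fin n → ℝ) {z u : ℂ}
    {x : Fin n → ℂ} (hx : x ≠ 0)
    (h : A.map Complex.ofRealHom *ᵥ x + u • (fun i => (B i : ℂ)) = z • x)
    (hC : (fun i => (C i : ℂ)) ⬝ᵥ x = 0) : aeval z (transferNumerator A B C) = 0 := by
  set N : Matrix (Fin n) (Fin n) ℂ := Matrix.scalar (Fin n) z - A.map Complex.ofRealHom with hN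
  have hNx : N *ᵥ x = u • fun i => (B i : ℂ) := by
    rw [hN, sub_mulVec, sub_eq_iff_eq_add', h]
    ext i
    simp [scalar_apply, mulVec_diagonal]
  have hcl : Matrix.scalar (Fin n) z - (closedLoop A B C 1).map Complex.ofRealHom =
      N + vecMulVec (fun i => (B i : ℂ)) (fun i => (C i : ℂ)) := by
    ext i j
    simp [hN, closedLoop, vecMulVec_apply]
    ring
  rw [transferNumerator, map_sub, aeval_charpoly, aeval_charpoly, hcl, ← hN, sub_eq_zero]
  by_cases hu : u = 0
  · have h₁ : N.det = 0 := exists_mulVec_eq_zero_iff.1 ⟨x, hx, by rw [hNx, hu, zero_smul]⟩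
    rw [h₁, ← exists_mulVec_eq_zero_iff]
    refine ⟨x, hx, ?_⟩
    rw [add_mulVec, vecMulVec_mulVec, hC, hNx, hu]
    simp
  · -- here `B` is in the range of `N`, so the perturbation is the factor `1 + u⁻¹ x C` of
    -- determinant `1 + u⁻¹ C x = 1`, even if `N` is singular
    have h₁ : N + vecMulVec (fun i => (B i : ℂ)) (fun i => (C i : ℂ)) =
        N * (1 + vecMulVec (u⁻¹ • x) (fun i => (C i : ℂ))) := by
      rw [Matrix.mul_add, Matrix.mul_one, mul_vecMulVec, mulVec_smul, hNx, smul_smul,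
        inv_mul_cancel₀ hu, one_smul]
    rw [h₁, det_mul, det_one_add_vecMulVec, dotProduct_smul, hC]
    simp

/-- A zero `z` of the transfer function at which some closed-loop matrix has no eigenvalue comes
with a nonzero state `x` such that `C x = 0` and `(z - A_K) x = B`. -/
theorem exists_of_aeval_transferNumerator_eq_zero (A : Matrix (Fin n) (Fin n) ℝ) (B C : Fin n → ℝ)
    (hB : B ≠ 0) (K : ℝ) {z : ℂ} (hz : aeval z (closedLoop A B C K).charpoly ≠ 0)
    (hb : aeval z (transferNumerator A B C) = 0) :
    ∃ x : Fin n → ℂ, x ≠ 0 ∧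
      (closedLoop A B C K).map Complex.ofRealHom *ᵥ x + (1 : ℂ) • (fun i => (B i : ℂ)) = z • x ∧
      (fun i => (C i : ℂ)) ⬝ᵥ x = 0 := by
  set N : Matrix (Fin n) (Fin n) ℂ :=
    Matrix.scalar (Fin n) z - (closedLoop A B C K).map Complex.ofRealHom with hN
  have hdet : N.det ≠ 0 := by rwa [hN, ← aeval_charpoly]
  have hcl : Matrix.scalar (Fin n) z - (closedLoop A B C (K + 1)).map Complex.ofRealHom =
      N + vecMulVec (fun i => (B i : ℂ)) (fun i => (C i : ℂ)) := by
    ext i j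
    simp [hN, closedLoop, vecMulVec_apply]
    ring
  have heq : (N + vecMulVec (fun i => (B i : ℂ)) (fun i => (C i : ℂ))).det = N.det := by
    rw [← hcl, hN, ← aeval_charpoly, ← aeval_charpoly, charpoly_closedLoop, charpoly_closedLoop]
    simp [hb]
  have hNx : N *ᵥ (N⁻¹ *ᵥ fun i => (B i : ℂ)) = fun i => (B i : ℂ) := by
    rw [mulVec_mulVec, mul_nonsing_inv N hdet.isUnit, one_mulVec]
  refine ⟨N⁻¹ *ᵥ fun i => (B i : ℂ), ?_, ?_, ?_⟩
  · intro h0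
    rw [h0, mulVec_zero] at hNx
    exact hB (funext fun i => by simpa using (congrFun hNx i).symm)
  · nth_rewrite 2 [← hNx]
    rw [one_smul, hN, sub_mulVec, add_sub_cancel]
    ext i
    simp [scalar_apply, mulVec_diagonal]
  · rw [det_add_vecMulVec hdet.isUnit] at heq
    have := mul_left_cancel₀ hdet (heq.trans (mul_one _).symm)
    simpa using this

end Numerator

/-! ### Coefficients of Hurwitz polynomials -/

theorem coeff_mul_pos {p q : ℝ[X]} (hp : ∀ i ≤ p.natDegree, 0 < p.coeff i)
    (hq : ∀ i ≤ q.natDegree, 0 < q.coeff i) : ∀ i ≤ (p * q).natDegree, 0 < (p * q).coeff i := by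
  have nonneg : ∀ {r : ℝ[X]}, (∀ i ≤ r.natDegree, 0 < r.coeff i) → ∀ i, 0 ≤ r.coeff i := by
    intro r hr i
    rcases le_or_gt i r.natDegree with h | h
    · exact (hr i h).le
    · exact (coeff_eq_zero_of_natDegree_lt h).ge
  intro i hi
  have hi' := hi.trans natDegree_mul_le
  rw [coeff_mul]
  refine Finset.sum_pos' (fun x _ => mul_nonneg (nonneg hp _) (nonneg hq _))
    ⟨(min i p.natDegree, i - min i p.natDegree), ?_, ?_⟩
  · simp
  · exact mul_pos (hp _ (min_le_right _ _)) (hq _ (by dsimp only; omega))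

/-- A real Hurwitz polynomial with positive leading coefficient has positive coefficients, as it is
a product of linear and quadratic factors with positive coefficients. -/
theorem IsHurwitzPoly.coeff_pos {b : ℝ[X]} (hb : IsHurwitzPoly b) (hlc : 0 < b.leadingCoeff) :
    ∀ i ≤ b.natDegree, 0 < b.coeff i := by
  induction h : b.natDegree using Nat.strong_induction_on generalizing b with
  | _ d ih =>
  by_cases hd : b.natDegree = 0
  · intro i hi
    obtain rfl : i = b.natDegree := by omega
    exact hlc
  obtain ⟨z, hz⟩ : ∃ z : ℂ, aeval z b = 0 :=
    IsAlgClosed.exists_aeval_eq_zero ℂ b (fun h0 => hd (natDegree_eq_of_degree_eq_some h0))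
  have hre := hb z hz
  -- a monic factor of positive degree with positive coefficients is enough
  have key : ∀ q : ℝ[X], q.Monic → 0 < q.natDegree → (∀ i ≤ q.natDegree, 0 < q.coeff i) → q ∣ b →
      ∀ i ≤ d, 0 < b.coeff i := by
    rintro q hq hq0 hqpos ⟨c, rfl⟩
    have hc : 0 < c.leadingCoeff := by rwa [leadingCoeff_mul, hq.leadingCoeff, one_mul] at hlc
    have hc0 : c ≠ 0 := leadingCoeff_ne_zero.1 hc.ne'
    have hdeg := hq.natDegree_mul' hc0
    have hcH : IsHurwitzPoly c := fun w hw => hb w (by rw [map_mul, hw, mul_zero])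
    rw [← h]
    exact coeff_mul_pos hqpos (ih c.natDegree (by omega) hcH hc rfl)
  by_cases him : z.im = 0
  · have hzr : z = (z.re : ℂ) := Complex.ext rfl (by simpa using him)
    refine key (X - Polynomial.C z.re) (monic_X_sub_C _) (by simp) ?_ ?_
    · intro i hi
      rw [natDegree_X_sub_C] at hi
      interval_cases i
      · simpa using hre
      · simp
    · rw [dvd_iff_isRoot, IsRoot.def]
      rw [hzr, ← Complex.coe_algebraMap, aeval_algebraMap_apply] at hz
      simpa using hz
  · have hq := quadratic_dvd_of_aeval_eq_zero_im_ne_zero b hz him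
    have hform : X ^ 2 - Polynomial.C (2 * z.re) * X + Polynomial.C (‖z‖ ^ 2) =
        Polynomial.C 1 * X ^ 2 + Polynomial.C (-(2 * z.re)) * X + Polynomial.C (‖z‖ ^ 2) := by
      simp only [map_neg, map_one]; ring
    rw [hform] at hq
    have hdeg := natDegree_quadratic (a := (1 : ℝ)) (b := -(2 * z.re)) (c := ‖z‖ ^ 2) one_ne_zero
    refine key _ ?_ (by rw [hdeg]; norm_num) ?_ hq
    · rw [Monic, leadingCoeff_quadratic one_ne_zero]
    · have hz0 : z ≠ 0 := fun h0 => him (by simp [h0])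
      intro i hi
      rw [hdeg] at hi
      interval_cases i
      · have : 0 < ‖z‖ ^ 2 := by positivity
        simpa [-map_pow] using this
      · have : 2 * z.re < 0 := by linarith
        simpa [-map_pow, coeff_C] using this
      · simp [-map_pow]

/-! ### Quadratic forms and Finsler's lemma -/

section QuadForm

variable {n : ℕ}

theorem posDef_iff_quadForm {S : Matrix (Fin n) (Fin n) ℝ} :
    S.PosDef ↔ Sᵀ = S ∧ ∀ x, x ≠ 0 → 0 < quadForm S x := by
  rw [posDef_iff_dotProduct_mulVec, IsHermitian, conjTranspose_eq_transpose_of_trivial]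
  simp [quadForm]

theorem quadForm_add (S R : Matrix (Fin n) (Fin n) ℝ) (x : Fin n → ℝ) :
    quadForm (S + R) x = quadForm S x + quadForm R x := by
  simp [quadForm, add_mulVec]

theorem quadForm_sub (S R : Matrix (Fin n) (Fin n) ℝ) (x : Fin n → ℝ) :
    quadForm (S - R) x = quadForm S x - quadForm R x := by
  simp [quadForm, sub_mulVec]

theorem quadForm_neg (S : Matrix (Fin n) (Fin n) ℝ) (x : Fin n → ℝ) :
    quadForm (-S) x = -quadForm S x := by
  simp [quadForm, neg_mulVec]

theorem quadForm_smul_left (k : ℝ) (S : Matrix (Fin n) (Fin n) ℝ) (x : Fin n → ℝ) :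
    quadForm (k • S) x = k * quadForm S x := by
  simp [quadForm, smul_mulVec]

theorem quadForm_smul (S : Matrix (Fin n) (Fin n) ℝ) (c : ℝ) (x : Fin n → ℝ) :
    quadForm S (c • x) = c ^ 2 * quadForm S x := by
  simp only [quadForm, mulVec_smul, dotProduct_smul, smul_dotProduct, smul_eq_mul]
  ring

theorem quadForm_mul (M N : Matrix (Fin n) (Fin n) ℝ) (x : Fin n → ℝ) :
    quadForm (M * N) x = (Mᵀ *ᵥ x) ⬝ᵥ (N *ᵥ x) := by
  rw [quadForm, ← mulVec_mulVec, dotProduct_mulVec, mulVec_transpose]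

theorem quadForm_transpose (S : Matrix (Fin n) (Fin n) ℝ) (x : Fin n → ℝ) :
    quadForm Sᵀ x = quadForm S x := by
  rw [quadForm, mulVec_transpose, dotProduct_comm, ← dotProduct_mulVec, quadForm]

theorem quadForm_vecMulVec_self (C x : Fin n → ℝ) :
    quadForm (vecMulVec C C) x = (C ⬝ᵥ x) ^ 2 := by
  rw [quadForm, vecMulVec_mulVec, dotProduct_comm x]
  simp
  ring

theorem continuous_quadForm (S : Matrix (Fin n) (Fin n) ℝ) : Continuous (quadForm S) :=
  continuous_id.dotProduct (continuous_const.matrix_mulVec continuous_id)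

/-- **Finsler's lemma**: a symmetric matrix that is positive definite on the null space of a
positive semidefinite `R` becomes positive definite after adding a large multiple of `R`. -/
theorem exists_forall_posDef_add_smul {S R : Matrix (Fin n) (Fin n) ℝ} (hS : Sᵀ = S) (hR : Rᵀ = R)
    (hR0 : ∀ x, 0 ≤ quadForm R x) (h : ∀ x, x ≠ 0 → quadForm R x = 0 → 0 < quadForm S x) :
    ∃ k₀ : ℝ, 0 < k₀ ∧ ∀ k, k₀ ≤ k → (S + k • R).PosDef := by
  -- the unit vectors on which `S + k R` is not positive form decreasing compact sets
  let F : ℕ → Set (Fin n → ℝ) := fun k =>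
    Metric.sphere 0 1 ∩ {x | quadForm S x + k * quadForm R x ≤ 0}
  have hclosed : ∀ k, IsClosed (F k) := fun k =>
    Metric.isClosed_sphere.inter (isClosed_le
      ((continuous_quadForm S).add (continuous_const.mul (continuous_quadForm R)))
      continuous_const)
  obtain ⟨k, hk⟩ : ∃ k, ¬ (F k).Nonempty := by
    by_contra! hne
    obtain ⟨x, hx⟩ := IsCompact.nonempty_iInter_of_sequence_nonempty_isCompact_isClosed F
      (fun i x hx => ⟨hx.1, by
        have h₁ := hx.2
        simp only [Set.mem_ofPred_eq, Nat.cast_add, Nat.cast_one] at h₁ ⊢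
        linarith [hR0 x]⟩)
      hne ((isCompact_sphere 0 1).of_isClosed_subset (hclosed 0) Set.inter_subset_left) hclosed
    rw [Set.mem_iInter] at hx
    have hx0 : x ≠ 0 := ne_zero_of_mem_unit_sphere ⟨x, (hx 0).1⟩
    have hRx : quadForm R x = 0 := by
      by_contra hne0
      have hpos := lt_of_le_of_ne (hR0 x) (Ne.symm hne0)
      obtain ⟨m, hm⟩ := exists_nat_gt (-quadForm S x / quadForm R x)
      rw [div_lt_iff₀ hpos] at hm
      have := (hx m).2
      simp only [Set.mem_ofPred_eq] at this
      linarith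
    have h₁ := (hx 0).2
    simp only [Set.mem_ofPred_eq, hRx, mul_zero, add_zero] at h₁
    exact absurd (h x hx0 hRx) (not_lt.2 h₁)
  refine ⟨k + 1, by positivity, fun l hl => posDef_iff_quadForm.2 ⟨?_, fun x hx => ?_⟩⟩
  · rw [transpose_add, transpose_smul, hS, hR]
  · have hnorm : 0 < ‖x‖ := norm_pos_iff.2 hx
    have hmem : (‖x‖⁻¹ • x) ∈ Metric.sphere (0 : Fin n → ℝ) 1 := by
      rw [mem_sphere_zero_iff_norm, norm_smul, norm_inv, norm_norm, inv_mul_cancel₀ hnorm.ne']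
    have h₁ : 0 < quadForm S (‖x‖⁻¹ • x) + k * quadForm R (‖x‖⁻¹ • x) := by
      by_contra hle
      exact hk ⟨_, hmem, not_lt.1 hle⟩
    rw [quadForm_smul, quadForm_smul] at h₁
    have h₂ : 0 < quadForm S x + k * quadForm R x := by
      have : 0 < (‖x‖⁻¹ ^ 2) * (quadForm S x + k * quadForm R x) := by linarith
      exact (pos_iff_pos_of_mul_pos this).1 (by positivity)
    rw [quadForm_add, quadForm_smul_left]
    nlinarith [hR0 x]

/-- Finsler's lemma for `S = -P` and `R = N`, whose null space is trivial. -/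
theorem exists_forall_posDef_sub_smul {N P : Matrix (Fin n) (Fin n) ℝ} (hN : N.PosDef)
    (hP : Pᵀ = P) : ∃ μ₀ : ℝ, 0 < μ₀ ∧ ∀ μ, 0 < μ → μ ≤ μ₀ → (N - μ • P).PosDef := by
  have hN' := posDef_iff_quadForm.1 hN
  obtain ⟨k₀, hk₀, hk⟩ := exists_forall_posDef_add_smul (S := -P) (R := N)
    (by rw [transpose_neg, hP]) hN'.1
    (fun x => by
      by_cases hx : x = 0
      · simp [hx, quadForm]
      · exact (hN'.2 x hx).le)
    (fun x hx h0 => absurd h0 (hN'.2 x hx).ne')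
  refine ⟨k₀⁻¹, by positivity, fun μ hμ hle => ?_⟩
  have h := (hk μ⁻¹ ((le_inv_comm₀ hk₀ hμ).2 hle)).smul hμ
  rwa [smul_add, smul_smul, mul_inv_cancel₀ hμ.ne', one_smul, smul_neg, neg_add_eq_sub] at h

end QuadForm

/-! ### Lyapunov's theorem -/

section Lyapunov

open Filter Topology ENNReal
open scoped Matrix.Norms.Frobenius

theorem exists_norm_pow_le_of_spectralRadius_lt_one {A : Type*} [NormedRing A] [NormedAlgebra ℂ A]
    [CompleteSpace A] {a : A} (h : spectralRadius ℂ a < 1) :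
    ∃ r : ℝ, 0 ≤ r ∧ r < 1 ∧ ∀ᶠ k : ℕ in atTop, ‖a ^ k‖ ≤ r ^ k := by
  obtain ⟨r, hr, hr1⟩ := ENNReal.lt_iff_exists_nnreal_btwn.1 h
  refine ⟨r, r.2, by exact_mod_cast hr1, ?_⟩
  filter_upwards [(spectrum.pow_nnnorm_pow_one_div_tendsto_nhds_spectralRadius a).eventually_lt_const
    hr, eventually_gt_atTop 0] with k hk hk0
  have hk0' : (0 : ℝ) < k := by exact_mod_cast hk0
  have h₁ : (‖a ^ k‖₊ : ℝ≥0∞) ≤ (r : ℝ≥0∞) ^ k := by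
    have := ENNReal.rpow_le_rpow hk.le hk0'.le
    rwa [← ENNReal.rpow_mul, one_div, inv_mul_cancel₀ hk0'.ne', ENNReal.rpow_one,
      ENNReal.rpow_natCast] at this
  exact_mod_cast h₁

variable {n : ℕ}

/-- A real matrix whose complex spectral radius is less than `1` admits a solution of the
Stein equation `H - Tᵀ H T = 1`, namely `H = ∑ₖ (Tᵏ)ᵀ Tᵏ`. -/
theorem exists_posDef_sub_transpose_mul_mul_eq_one {T : Matrix (Fin n) (Fin n) ℝ}
    (hT : spectralRadius ℂ (T.map Complex.ofRealHom) < 1) :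
    ∃ H : Matrix (Fin n) (Fin n) ℝ, H.PosDef ∧ H - Tᵀ * H * T = 1 := by
  obtain ⟨r, hr0, hr1, hr⟩ := exists_norm_pow_le_of_spectralRadius_lt_one hT
  have hsum : Summable fun k : ℕ => (T ^ k)ᵀ * T ^ k := by
    refine Summable.of_norm_bounded_eventually_nat (g := fun k => (r ^ 2) ^ k)
      (summable_geometric_of_lt_one (by positivity) (by nlinarith)) ?_
    filter_upwards [hr] with k hk
    have hnorm : ‖T ^ k‖ ≤ r ^ k := by
      rw [← Matrix.map_pow, frobenius_norm_map_eq _ _ (fun a => by simp)] at hk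
      exact hk
    calc ‖(T ^ k)ᵀ * T ^ k‖ ≤ ‖(T ^ k)ᵀ‖ * ‖T ^ k‖ := norm_mul_le _ _
      _ = ‖T ^ k‖ ^ 2 := by rw [frobenius_norm_transpose, sq]
      _ ≤ (r ^ k) ^ 2 := by gcongr
      _ = (r ^ 2) ^ k := by rw [← pow_mul, ← pow_mul, mul_comm]
  set H : Matrix (Fin n) (Fin n) ℝ := ∑' k : ℕ, (T ^ k)ᵀ * T ^ k with hH
  have hstein : H - Tᵀ * H * T = 1 := by
    have h₁ : H = 1 + ∑' k : ℕ, (T ^ (k + 1))ᵀ * T ^ (k + 1) := by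
      rw [hH, hsum.tsum_eq_zero_add]
      simp
    have h₂ : Tᵀ * H * T = ∑' k : ℕ, (T ^ (k + 1))ᵀ * T ^ (k + 1) := by
      rw [hH, ← hsum.tsum_mul_left, ← (hsum.mul_left _).tsum_mul_right]
      refine tsum_congr fun k => ?_
      rw [pow_succ, transpose_mul]
      simp only [Matrix.mul_assoc]
    rw [h₂, h₁, add_sub_cancel_right]
  have hsymm : Hᵀ = H := by
    rw [hH, transpose_tsum]
    refine tsum_congr fun k => ?_
    rw [transpose_mul, transpose_transpose]
  have hnonneg : ∀ x, 0 ≤ quadForm H x := by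
    intro x
    have hq : Continuous fun M : Matrix (Fin n) (Fin n) ℝ => quadForm M x :=
      continuous_const.dotProduct (continuous_id.matrix_mulVec continuous_const)
    have hs := hsum.hasSum.map (⟨⟨fun M => quadForm M x, by simp [quadForm]⟩,
      fun M N => quadForm_add M N x⟩ : Matrix (Fin n) (Fin n) ℝ →+ ℝ) hq
    refine hs.nonneg fun k => ?_
    change 0 ≤ quadForm ((T ^ k)ᵀ * T ^ k) x
    rw [quadForm_mul, transpose_transpose]
    exact dotProduct_star_self_nonneg (T ^ k *ᵥ x)
  refine ⟨H, posDef_iff_quadForm.2 ⟨hsymm, fun x hx => ?_⟩, hstein⟩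
  have hHeq : H = 1 + Tᵀ * H * T := by rw [← hstein]; abel
  rw [hHeq, quadForm_add, Matrix.mul_assoc, quadForm_mul, transpose_transpose, ← mulVec_mulVec]
  have h₁ : 0 < quadForm 1 x := by
    rw [quadForm, one_mulVec]
    exact lt_of_le_of_ne (dotProduct_star_self_nonneg x)
      (fun h => hx (dotProduct_self_eq_zero.1 h.symm))
  exact add_pos_of_pos_of_nonneg h₁ (hnonneg (T *ᵥ x))

/-- **Lyapunov's theorem**: if all complex eigenvalues of a real matrix `Z` have negative real
part, then `H Z + Zᵀ H` is negative definite for some positive definite `H`. The Stein equation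
for `T = 1 + ε Z` gives such an `H` once `ε > 0` is so small that the spectral radius of `T` is
less than `1`. -/
theorem exists_posDef_lyapunov {Z : Matrix (Fin n) (Fin n) ℝ}
    (hZ : ∀ (z : ℂ) (x : Fin n → ℂ), x ≠ 0 → Z.map Complex.ofRealHom *ᵥ x = z • x → z.re < 0) :
    ∃ H : Matrix (Fin n) (Fin n) ℝ, H.PosDef ∧ (-(H * Z + Zᵀ * H)).PosDef := by
  rcases Nat.eq_zero_or_pos n with rfl | hn
  · exact ⟨1, PosDef.one, by
      rw [Subsingleton.elim (-(1 * Z + Zᵀ * 1)) (1 : Matrix (Fin 0) (Fin 0) ℝ)]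
      exact PosDef.one⟩
  have : Nonempty (Fin n) := ⟨⟨0, hn⟩⟩
  set ZC : Matrix (Fin n) (Fin n) ℂ := Z.map Complex.ofRealHom with hZC
  have hspec : ∀ z ∈ spectrum ℂ ZC, z.re < 0 := by
    intro z hz
    rw [spectrum.mem_iff, isUnit_iff_isUnit_det, isUnit_iff_ne_zero, not_not,
      ← exists_mulVec_eq_zero_iff] at hz
    obtain ⟨x, hx, hx0⟩ := hz
    refine hZ z x hx ?_
    rw [sub_mulVec, sub_eq_zero] at hx0
    rw [← hx0]
    ext i
    simp [algebraMap_eq_diagonal, mulVec_diagonal]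
  have hfin : (spectrum ℂ ZC).Finite := Matrix.finite_spectrum ZC
  obtain ⟨ε, hε, hε0⟩ : ∃ ε : ℝ, (∀ z ∈ spectrum ℂ ZC, 2 * z.re + ε * ‖z‖ ^ 2 < 0) ∧ 0 < ε := by
    have hev : ∀ᶠ ε : ℝ in 𝓝[>] 0, ∀ z ∈ spectrum ℂ ZC, 2 * z.re + ε * ‖z‖ ^ 2 < 0 := by
      rw [eventually_all_finite hfin]
      intro z hz
      have hcont : Continuous fun ε : ℝ => 2 * z.re + ε * ‖z‖ ^ 2 := by fun_prop
      have := hcont.tendsto 0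
      exact (this.mono_left nhdsWithin_le_nhds).eventually_lt_const (by
        have := hspec z hz
        linarith)
    exact (hev.and self_mem_nhdsWithin).exists
  have hT : spectralRadius ℂ ((1 + ε • Z).map Complex.ofRealHom) < 1 := by
    have hmap : (1 + ε • Z).map Complex.ofRealHom = algebraMap ℂ _ 1 + (ε : ℂ) • ZC := by
      ext i j
      simp [hZC, one_apply, apply_ite]
    refine spectrum.spectralRadius_lt_of_forall_lt (r := 1) _ fun w hw => ?_
    have hε' : (ε : ℂ) ≠ 0 := by exact_mod_cast hε0.ne'
    rw [hmap, ← spectrum.singleton_add_eq, ← Units.val_mk0 hε', ← Units.smul_def,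
      spectrum.unit_smul_eq_smul] at hw
    simp only [Set.singleton_add, Set.mem_image] at hw
    obtain ⟨_, ⟨z, hz, rfl⟩, rfl⟩ := hw
    have h₁ := hε z hz
    rw [← NNReal.coe_lt_coe, coe_nnnorm, NNReal.coe_one, ← sq_lt_one_iff₀ (norm_nonneg _)]
    rw [← Complex.normSq_eq_norm_sq, Complex.normSq_apply] at h₁ ⊢
    simp
    nlinarith
  obtain ⟨H, hH, hst⟩ := exists_posDef_sub_transpose_mul_mul_eq_one hT
  refine ⟨H, hH, ?_⟩
  have key : -(H * Z + Zᵀ * H) = ε⁻¹ • (1 : Matrix (Fin n) (Fin n) ℝ) + ε • (Zᵀ * H * Z) := by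
    rw [← hst]
    simp only [transpose_add, transpose_one, transpose_smul, Matrix.add_mul, Matrix.mul_add,
      Matrix.one_mul, Matrix.mul_one, Matrix.smul_mul, Matrix.mul_smul, smul_add, smul_sub,
      smul_smul, inv_mul_cancel₀ hε0.ne', one_smul, inv_mul_cancel_left₀ hε0.ne', Matrix.mul_assoc]
    abel
  rw [key]
  have h₁ : (ε⁻¹ • (1 : Matrix (Fin n) (Fin n) ℝ)).PosDef := PosDef.one.smul (by positivity)
  refine h₁.add_posSemidef (PosSemidef.smul ?_ hε0.le)
  have := hH.posSemidef.conjTranspose_mul_mul_same Z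
  rwa [conjTranspose_eq_transpose_of_trivial] at this

end Lyapunov

/-! ### Lyapunov functions of the closed loop -/

section ClosedLoop

variable {n : ℕ}

theorem dotProduct_mulVec_comm_of_symm {P : Matrix (Fin n) (Fin n) ℝ} (hP : Pᵀ = P)
    (x y : Fin n → ℝ) : x ⬝ᵥ (P *ᵥ y) = y ⬝ᵥ (P *ᵥ x) := by
  rw [dotProduct_mulVec, ← mulVec_transpose, hP, dotProduct_comm]

theorem quadForm_add_right {P : Matrix (Fin n) (Fin n) ℝ} (hP : Pᵀ = P) (x y : Fin n → ℝ) :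
    quadForm P (x + y) = quadForm P x + 2 * (x ⬝ᵥ (P *ᵥ y)) + quadForm P y := by
  simp only [quadForm, mulVec_add, dotProduct_add, add_dotProduct]
  rw [dotProduct_mulVec_comm_of_symm hP y x]
  ring

theorem differentiable_quadForm (P : Matrix (Fin n) (Fin n) ℝ) :
    Differentiable ℝ (quadForm P) := by
  unfold quadForm dotProduct mulVec dotProduct
  fun_prop

theorem fderiv_quadForm {P : Matrix (Fin n) (Fin n) ℝ} (hP : Pᵀ = P) (e v : Fin n → ℝ) :
    fderiv ℝ (quadForm P) e v = 2 * (e ⬝ᵥ (P *ᵥ v)) := by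
  rw [← (differentiable_quadForm P e).lineDeriv_eq_fderiv, lineDeriv]
  have h : (fun t : ℝ => quadForm P (e + t • v)) =
      fun t => quadForm P e + t * (2 * (e ⬝ᵥ (P *ᵥ v))) + t ^ 2 * quadForm P v := by
    funext t
    rw [quadForm_add_right hP, quadForm_smul, mulVec_smul, dotProduct_smul, smul_eq_mul]
    ring
  rw [h]
  have h₁ : HasDerivAt (fun t : ℝ => quadForm P e + t * (2 * (e ⬝ᵥ (P *ᵥ v))) +
      t ^ 2 * quadForm P v) _ 0 :=
    (((hasDerivAt_id (0 : ℝ)).mul_const _).const_add _).add ((hasDerivAt_pow 2 (0 : ℝ)).mul_const _)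
  rw [h₁.deriv]
  simp

theorem quadForm_mul_add_transpose_mul {P : Matrix (Fin n) (Fin n) ℝ} (hP : Pᵀ = P)
    (M : Matrix (Fin n) (Fin n) ℝ) (x : Fin n → ℝ) :
    quadForm (P * M + Mᵀ * P) x = 2 * (x ⬝ᵥ (P *ᵥ (M *ᵥ x))) := by
  have h : Mᵀ * P = (P * M)ᵀ := by rw [transpose_mul, hP]
  rw [quadForm_add, h, quadForm_transpose, quadForm, ← mulVec_mulVec]
  ring

theorem transpose_mul_add_transpose_mul {P : Matrix (Fin n) (Fin n) ℝ} (hP : Pᵀ = P)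
    (M : Matrix (Fin n) (Fin n) ℝ) : (P * M + Mᵀ * P)ᵀ = P * M + Mᵀ * P := by
  rw [transpose_add, transpose_mul, transpose_mul, transpose_transpose, hP, add_comm]

theorem lyapunovDeriv_eq {P : Matrix (Fin n) (Fin n) ℝ} (hP : Pᵀ = P)
    (A : Matrix (Fin n) (Fin n) ℝ) (B C : Fin n → ℝ) (K : ℝ) (e : Fin n → ℝ) (ξ : ℝ) :
    lyapunovDeriv A B C K P e ξ =
      quadForm (P * closedLoop A B C K + (closedLoop A B C K)ᵀ * P) e +
        2 * ξ * (e ⬝ᵥ (P *ᵥ B)) := by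
  rw [lyapunovDeriv, fderiv_quadForm hP, quadForm_mul_add_transpose_mul hP, mulVec_add,
    mulVec_smul, dotProduct_add, dotProduct_smul, smul_eq_mul]
  ring

theorem passifyingRel_zero_iff {P A : Matrix (Fin n) (Fin n) ℝ} {B C : Fin n → ℝ} {K : ℝ} :
    PassifyingRel A B C K 0 P ↔
      (-(P * closedLoop A B C K + (closedLoop A B C K)ᵀ * P)).PosDef ∧ P *ᵥ B = C := by
  rw [PassifyingRel, zero_smul, neg_zero, zero_sub]

theorem neg_lyapunov_closedLoop {P : Matrix (Fin n) (Fin n) ℝ} (hP : Pᵀ = P)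
    (A : Matrix (Fin n) (Fin n) ℝ) {B C : Fin n → ℝ} (hPB : P *ᵥ B = C) (K : ℝ) :
    -(P * closedLoop A B C K + (closedLoop A B C K)ᵀ * P) =
      -(P * A + Aᵀ * P) + (2 * K) • vecMulVec C C := by
  have hBP : B ᵥ* P = C := by rw [← mulVec_transpose, hP, hPB]
  rw [closedLoop, transpose_sub, transpose_smul, transpose_vecMulVec, Matrix.mul_sub,
    Matrix.sub_mul, Matrix.mul_smul, Matrix.smul_mul, mul_vecMulVec, vecMulVec_mul, hPB, hBP,
    two_mul, add_smul]
  abel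

/-- For `P B = Cᵀ` a larger gain only subtracts a multiple of `Cᵀ C` from `P A_K + A_Kᵀ P`. -/
theorem PassifyingRel.mono_gain {P A : Matrix (Fin n) (Fin n) ℝ} {B C : Fin n → ℝ} {K K' μ : ℝ}
    (hP : Pᵀ = P) (h : PassifyingRel A B C K μ P) (hK : K ≤ K') : PassifyingRel A B C K' μ P := by
  obtain ⟨hM, hPB⟩ := h
  refine ⟨?_, hPB⟩
  have hCC : (vecMulVec C C).PosSemidef := by simpa using posSemidef_vecMulVec_self_star C
  have h₁ := hM.add_posSemidef (hCC.smul (show (0 : ℝ) ≤ 2 * (K' - K) by linarith))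
  rw [sub_eq_add_neg, neg_lyapunov_closedLoop hP A hPB] at h₁ ⊢
  convert h₁ using 1
  rw [mul_sub, sub_smul]
  abel

theorem PassifyingRel.exists_rate {P A : Matrix (Fin n) (Fin n) ℝ} {B C : Fin n → ℝ} {K : ℝ}
    (hP : Pᵀ = P) (h : PassifyingRel A B C K 0 P) :
    ∃ μ₀ : ℝ, 0 < μ₀ ∧ ∀ μ : ℝ, 0 < μ → μ ≤ μ₀ → PassifyingRel A B C K μ P := by
  obtain ⟨hM, hPB⟩ := passifyingRel_zero_iff.1 h
  obtain ⟨μ₀, hμ₀, hμ⟩ := exists_forall_posDef_sub_smul hM hP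
  refine ⟨μ₀, hμ₀, fun μ h₁ h₂ => ⟨?_, hPB⟩⟩
  rw [← neg_add', add_comm, neg_add']
  exact hμ μ h₁ h₂

theorem PassifyingRel.lyapunovDeriv_lt {P A : Matrix (Fin n) (Fin n) ℝ} {B C : Fin n → ℝ}
    {K μ : ℝ} (hP : Pᵀ = P) (h : PassifyingRel A B C K μ P) {e : Fin n → ℝ} (he : e ≠ 0) {ξ : ℝ}
    (hξ : ξ * (C ⬝ᵥ e) ≤ 0) : lyapunovDeriv A B C K P e ξ < -μ * quadForm P e := by
  obtain ⟨hM, hPB⟩ := h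
  have h₁ := (posDef_iff_quadForm.1 hM).2 e he
  rw [quadForm_sub, quadForm_neg, quadForm_smul_left] at h₁
  rw [lyapunovDeriv_eq hP, hPB, dotProduct_comm]
  linarith

/-- If `M` satisfies the Lyapunov inequality with `P` and `(z - M) x = w B` for some `x ≠ 0`, where
`w = 0` or `x` is orthogonal to `P B`, then `z` has negative real part. For `w = 0` this says that
`M` is stable, for `w = 1` it bounds the zeros of the transfer function. -/
theorem re_neg_of_lyapunov {P M : Matrix (Fin n) (Fin n) ℝ} (hP : P.PosDef)
    (hM : (-(P * M + Mᵀ * P)).PosDef) {B : Fin n → ℝ} {z w : ℂ} {x : Fin n → ℂ} (hx : x ≠ 0)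
    (h : M.map Complex.ofRealHom *ᵥ x + w • (fun i => (B i : ℂ)) = z • x)
    (hw : w = 0 ∨ (fun i => ((P *ᵥ B) i : ℂ)) ⬝ᵥ x = 0) : z.re < 0 := by
  obtain ⟨hPs, hPpos⟩ := posDef_iff_quadForm.1 hP
  set u : Fin n → ℝ := fun i => (x i).re with hu
  set v : Fin n → ℝ := fun i => (x i).im with hv
  have hre : M *ᵥ u = z.re • u - z.im • v - w.re • B := by
    funext i
    have := congrArg Complex.re (congrFun h i)
    simp [mulVec, dotProduct] at this
    simp [mulVec, dotProduct, hu, hv]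
    linarith
  have him : M *ᵥ v = z.re • v + z.im • u - w.im • B := by
    funext i
    have := congrArg Complex.im (congrFun h i)
    simp [mulVec, dotProduct] at this
    simp [mulVec, dotProduct, hu, hv]
    linarith
  have hwu : w.re * (u ⬝ᵥ (P *ᵥ B)) = 0 ∧ w.im * (v ⬝ᵥ (P *ᵥ B)) = 0 := by
    rcases hw with rfl | hw
    · simp
    · have h₁ : u ⬝ᵥ (P *ᵥ B) = 0 := by
        have := congrArg Complex.re hw
        simp [dotProduct] at this
        rw [dotProduct_comm]
        simpa [dotProduct, hu] using this
      have h₂ : v ⬝ᵥ (P *ᵥ B) = 0 := by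
        have := congrArg Complex.im hw
        simp [dotProduct] at this
        rw [dotProduct_comm]
        simpa [dotProduct, hv] using this
      simp [h₁, h₂]
  -- the terms with `z.im` cancel because `P` is symmetric
  have hsum : quadForm (-(P * M + Mᵀ * P)) u + quadForm (-(P * M + Mᵀ * P)) v =
      -(2 * z.re) * (quadForm P u + quadForm P v) := by
    rw [quadForm_neg, quadForm_neg, quadForm_mul_add_transpose_mul hPs,
      quadForm_mul_add_transpose_mul hPs, hre, him]
    simp only [mulVec_add, mulVec_sub, mulVec_smul, dotProduct_add, dotProduct_sub,
      dotProduct_smul, smul_eq_mul, quadForm]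
    rw [dotProduct_mulVec_comm_of_symm hPs v u]
    linarith [hwu.1, hwu.2]
  have huv : u ≠ 0 ∨ v ≠ 0 := by
    by_contra! h0
    exact hx (funext fun i => Complex.ext (congrFun h0.1 i) (congrFun h0.2 i))
  have pos : ∀ {S : Matrix (Fin n) (Fin n) ℝ}, S.PosDef → 0 < quadForm S u + quadForm S v := by
    intro S hS
    have hS' := (posDef_iff_quadForm.1 hS).2
    have hnn : ∀ y, 0 ≤ quadForm S y := fun y => by
      by_cases hy : y = 0
      · simp [hy, quadForm]
      · exact (hS' y hy).le
    rcases huv with hne | hne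
    · exact add_pos_of_pos_of_nonneg (hS' _ hne) (hnn _)
    · exact add_pos_of_nonneg_of_pos (hnn _) (hS' _ hne)
  have h₁ := pos hM
  have h₂ := pos hP
  rw [hsum] at h₁
  by_contra! hz
  nlinarith

theorem isHMP_of_passifyingRel {A P : Matrix (Fin n) (Fin n) ℝ} {B C : Fin n → ℝ} {K : ℝ}
    (hB : B ≠ 0) (hP : P.PosDef) (h : PassifyingRel A B C K 0 P) : IsHMP A B C := by
  obtain ⟨hM, hPB⟩ := passifyingRel_zero_iff.1 h
  have hn : 0 < n := by
    rcases Nat.eq_zero_or_pos n with rfl | hn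
    · exact absurd (Subsingleton.elim B 0) hB
    · exact hn
  have hCB : 0 < C ⬝ᵥ B := by
    rw [← hPB, dotProduct_comm]
    exact (posDef_iff_quadForm.1 hP).2 B hB
  have hdeg := natDegree_transferNumerator A B C hn hCB.ne'
  have hH : IsHurwitzPoly (transferNumerator A B C) := by
    intro z hz
    by_cases hK : aeval z (closedLoop A B C K).charpoly = 0
    · rw [aeval_charpoly, ← exists_mulVec_eq_zero_iff] at hK
      obtain ⟨x, hx, hx0⟩ := hK
      refine re_neg_of_lyapunov hP hM (B := B) (w := 0) hx ?_ (Or.inl rfl)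
      rw [sub_mulVec, sub_eq_zero] at hx0
      rw [zero_smul, add_zero, ← hx0]
      ext i
      simp [scalar_apply, mulVec_diagonal]
    · obtain ⟨x, hx, hx1, hx2⟩ := exists_of_aeval_transferNumerator_eq_zero A B C hB K hK hz
      exact re_neg_of_lyapunov hP hM hx hx1 (Or.inr (by rwa [hPB]))
  refine (isHMP_iff A B C).2 ⟨hdeg, hH.coeff_pos ?_, hH⟩
  rwa [leadingCoeff, show (transferNumerator A B C).natDegree = n - 1 by omega,
    coeff_transferNumerator A B C hn]

/-- If `V` decreases under the sector condition, then `P B` is a positive multiple of `C`: the input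
is unrestricted on `C e = 0`, so `P B` vanishes there, and inputs of large size and sign opposite to
`C e` determine the sign. Rescaling `P` gives the passifying relations. -/
theorem exists_passifyingRel_of_sector {A P : Matrix (Fin n) (Fin n) ℝ} {B C : Fin n → ℝ} {K : ℝ}
    (hB : B ≠ 0) (hP : P.PosDef) (h : ∀ e : Fin n → ℝ, e ≠ 0 → ∀ ξ : ℝ, ξ * (C ⬝ᵥ e) ≤ 0 →
      lyapunovDeriv A B C K P e ξ < 0) :
    ∃ P' : Matrix (Fin n) (Fin n) ℝ, P'.PosDef ∧ PassifyingRel A B C K 0 P' := by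
  obtain ⟨hPs, hPpos⟩ := posDef_iff_quadForm.1 hP
  set M := P * closedLoop A B C K + (closedLoop A B C K)ᵀ * P with hM
  set g := P *ᵥ B with hg
  replace h : ∀ e : Fin n → ℝ, e ≠ 0 → ∀ ξ : ℝ, ξ * (C ⬝ᵥ e) ≤ 0 →
      quadForm M e + 2 * ξ * (e ⬝ᵥ g) < 0 := fun e he ξ hξ => by
    simpa only [lyapunovDeriv_eq hPs] using h e he ξ hξ
  have hneg : ∀ e, e ≠ 0 → quadForm M e < 0 := fun e he => by simpa using h e he 0 (by simp)
  have hBg : 0 < B ⬝ᵥ g := hPpos B hB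
  have hker : ∀ e, C ⬝ᵥ e = 0 → e ⬝ᵥ g = 0 := by
    intro e he
    by_contra h0
    have he0 : e ≠ 0 := by rintro rfl; simp at h0
    -- the input for which the derivative vanishes
    have := h e he0 (-quadForm M e / (2 * (e ⬝ᵥ g))) (by simp [he])
    have h₁ : 2 * (-quadForm M e / (2 * (e ⬝ᵥ g))) * (e ⬝ᵥ g) = -quadForm M e := by field_simp
    linarith
  have hC : C ≠ 0 := by
    rintro rfl
    exact hBg.ne' (hker B (by simp))
  have hCC : 0 < C ⬝ᵥ C := lt_of_le_of_ne (dotProduct_star_self_nonneg C)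
    fun h0 => hC (dotProduct_self_eq_zero.1 h0.symm)
  obtain ⟨c, hgc⟩ : ∃ c : ℝ, g = c • C := by
    refine ⟨C ⬝ᵥ g / C ⬝ᵥ C, sub_eq_zero.1 (dotProduct_self_eq_zero.1 ?_)⟩
    have h₁ : C ⬝ᵥ (g - (C ⬝ᵥ g / C ⬝ᵥ C) • C) = 0 := by
      rw [dotProduct_sub, dotProduct_smul, smul_eq_mul, div_mul_cancel₀ _ hCC.ne', sub_self]
    have h₂ := hker _ h₁
    rw [dotProduct_comm] at h₁
    rw [dotProduct_sub _ g, h₂, dotProduct_smul, h₁, smul_zero, sub_zero]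
  have hc0 : c ≠ 0 := by
    rintro rfl
    rw [hgc] at hBg
    simp at hBg
  have hc : 0 < c := by
    by_contra! hle
    have hclt : c < 0 := lt_of_le_of_ne hle hc0
    have hq := hneg C hC
    -- for `c < 0` the input at which the derivative vanishes at the state `Cᵀ` is in the sector
    have hξ : -quadForm M C / (2 * (c * (C ⬝ᵥ C))) ≤ 0 :=
      div_nonpos_of_nonneg_of_nonpos (by linarith) (by nlinarith)
    have := h C hC _ (mul_nonpos_of_nonpos_of_nonneg hξ hCC.le)
    rw [hgc, dotProduct_smul, smul_eq_mul] at this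
    have h₁ : 2 * (-quadForm M C / (2 * (c * (C ⬝ᵥ C)))) * (c * (C ⬝ᵥ C)) = -quadForm M C := by
      field_simp
    linarith
  refine ⟨c⁻¹ • P, hP.smul (inv_pos.2 hc), passifyingRel_zero_iff.2 ⟨?_, ?_⟩⟩
  · have hMP : (-M).PosDef := posDef_iff_quadForm.2
      ⟨by rw [transpose_neg, hM, transpose_mul_add_transpose_mul hPs], fun x hx => by
        rw [quadForm_neg]
        linarith [hneg x hx]⟩
    have := hMP.smul (inv_pos.2 hc)
    rwa [smul_neg, hM, smul_add, ← Matrix.smul_mul, ← Matrix.mul_smul] at this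
  · rw [smul_mulVec, ← hg, hgc, smul_smul, inv_mul_cancel₀ hc.ne', one_smul]

/-- For a hyper-minimum-phase system, some positive definite `P` satisfies the passifying
relations for some gain. With the projection `Π = 1 - B C / (C B)` onto `ker C` along `B`, the matrix
`Z = Π A - B C` has the zeros of the transfer function and `-C B` as its eigenvalues; if `H` solves
the Lyapunov inequality for `Z`, then `P = Πᵀ H Π + Cᵀ C / (C B)` is as required, by Finsler's
lemma. -/
theorem exists_passifyingRel_of_isHMP {A : Matrix (Fin n) (Fin n) ℝ} {B C : Fin n → ℝ}
    (h : IsHMP A B C) : ∃ P : Matrix (Fin n) (Fin n) ℝ, P.PosDef ∧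
      ∃ K : ℝ, PassifyingRel A B C K 0 P := by
  obtain ⟨hdeg, hpos, hH⟩ := (isHMP_iff A B C).1 h
  have hγ : 0 < C ⬝ᵥ B := by
    rw [← coeff_transferNumerator A B C (by omega)]
    exact hpos _ (by omega)
  set γ := C ⬝ᵥ B with hγdef
  set Q : Matrix (Fin n) (Fin n) ℝ := 1 - γ⁻¹ • vecMulVec B C with hQ
  have hQB : Q *ᵥ B = 0 := by
    rw [hQ, sub_mulVec, smul_mulVec, vecMulVec_mulVec, ← hγdef, one_mulVec, op_smul_eq_smul,
      smul_smul, inv_mul_cancel₀ hγ.ne', one_smul, sub_self]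
  have hQker : ∀ e, C ⬝ᵥ e = 0 → Q *ᵥ e = e := by
    intro e he
    rw [hQ, sub_mulVec, smul_mulVec, vecMulVec_mulVec, he]
    simp
  -- `Z = Π A - B C` with `Π = Q`, written as a perturbation of `A` with range in the span of `B`
  set r : Fin n → ℝ := -(γ⁻¹ • (C ᵥ* A) + C) with hr
  set Z : Matrix (Fin n) (Fin n) ℝ := A + vecMulVec B r with hZ
  have hCZ : C ᵥ* Z = (-γ) • C := by
    rw [hZ, vecMul_add, vecMul_vecMulVec, ← hγdef, hr, smul_neg, smul_add, smul_smul,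
      mul_inv_cancel₀ hγ.ne', one_smul, neg_smul]
    abel
  have hZker : ∀ e, C ⬝ᵥ e = 0 → Z *ᵥ e = Q *ᵥ (A *ᵥ e) := by
    intro e he
    rw [hZ, hQ, add_mulVec, sub_mulVec, smul_mulVec, vecMulVec_mulVec, vecMulVec_mulVec, hr,
      one_mulVec, neg_dotProduct, add_dotProduct, he, smul_dotProduct, ← dotProduct_mulVec]
    ext i
    simp
    ring
  obtain ⟨H, hHpos, hHZ⟩ := exists_posDef_lyapunov (Z := Z) (by
    intro z x hx hzx
    by_contra! hz
    have hCx : (fun i => (C i : ℂ)) ⬝ᵥ x = 0 := by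
      have h₁ : (fun i => (C i : ℂ)) ᵥ* Z.map Complex.ofRealHom =
          (-γ : ℂ) • fun i => (C i : ℂ) := by
        ext i
        have := congrArg (Complex.ofRealHom) (congrFun hCZ i)
        rw [RingHom.map_vecMul] at this
        simpa [Function.comp_def] using this
      have h₂ := dotProduct_mulVec (fun i => (C i : ℂ)) (Z.map Complex.ofRealHom) x
      rw [hzx, h₁, dotProduct_smul, smul_dotProduct, smul_eq_mul, smul_eq_mul] at h₂
      have h₃ : (z + γ) * ((fun i => (C i : ℂ)) ⬝ᵥ x) = 0 := by linear_combination h₂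
      refine (mul_eq_zero.1 h₃).resolve_left fun h0 => ?_
      have := congrArg Complex.re h0
      simp at this
      linarith
    have hmap : Z.map Complex.ofRealHom = A.map Complex.ofRealHom +
        vecMulVec (fun i => (B i : ℂ)) (fun i => (r i : ℂ)) := by
      ext i j
      simp [hZ, vecMulVec_apply]
    rw [hmap, add_mulVec, vecMulVec_mulVec, op_smul_eq_smul] at hzx
    exact absurd (hH z (aeval_transferNumerator_eq_zero A B C hx hzx hCx)) (not_lt.2 hz))
  obtain ⟨hHs, hHq⟩ := posDef_iff_quadForm.1 hHpos
  set P : Matrix (Fin n) (Fin n) ℝ := Qᵀ * H * Q + γ⁻¹ • vecMulVec C C with hP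
  have hPs : Pᵀ = P := by
    rw [hP, transpose_add, transpose_smul, transpose_mul, transpose_mul, transpose_transpose, hHs,
      transpose_vecMulVec, Matrix.mul_assoc]
  have hPB : P *ᵥ B = C := by
    rw [hP, add_mulVec, ← mulVec_mulVec, hQB, mulVec_zero, zero_add, smul_mulVec, vecMulVec_mulVec,
      ← hγdef, op_smul_eq_smul, smul_smul, inv_mul_cancel₀ hγ.ne', one_smul]
  have hPq : ∀ e, quadForm P e = quadForm H (Q *ᵥ e) + γ⁻¹ * (C ⬝ᵥ e) ^ 2 := by
    intro e
    rw [hP, quadForm_add, quadForm_smul_left, quadForm_vecMulVec_self, Matrix.mul_assoc,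
      quadForm_mul, transpose_transpose, ← mulVec_mulVec, quadForm]
  have hHnn : ∀ y, 0 ≤ quadForm H y := fun y => by
    by_cases hy : y = 0
    · simp [hy, quadForm]
    · exact (hHq y hy).le
  have hPpos : P.PosDef := by
    refine posDef_iff_quadForm.2 ⟨hPs, fun e he => ?_⟩
    rw [hPq]
    by_cases hCe : C ⬝ᵥ e = 0
    · rw [hQker e hCe, hCe]
      simpa using hHq e he
    · exact add_pos_of_nonneg_of_pos (hHnn _) (by positivity)
  have hCC : (vecMulVec C C)ᵀ = vecMulVec C C := transpose_vecMulVec C C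
  obtain ⟨k₀, -, hk⟩ := exists_forall_posDef_add_smul (S := -(P * A + Aᵀ * P)) (R := vecMulVec C C)
    (by rw [transpose_neg, transpose_mul_add_transpose_mul hPs]) hCC
    (fun x => by rw [quadForm_vecMulVec_self]; positivity)
    (fun e he h0 => by
      rw [quadForm_vecMulVec_self, sq_eq_zero_iff] at h0
      have h₁ := (posDef_iff_quadForm.1 hHZ).2 e he
      have h₂ : P *ᵥ e = Qᵀ *ᵥ (H *ᵥ e) := by
        rw [hP, add_mulVec, ← mulVec_mulVec, ← mulVec_mulVec, hQker e h0, smul_mulVec,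
          vecMulVec_mulVec, h0]
        simp
      rw [quadForm_neg, quadForm_mul_add_transpose_mul hHs, hZker e h0,
        dotProduct_mulVec_comm_of_symm hHs] at h₁
      rwa [quadForm_neg, quadForm_mul_add_transpose_mul hPs, dotProduct_mulVec_comm_of_symm hPs, h₂,
        dotProduct_mulVec, vecMul_transpose])
  refine ⟨P, hPpos, k₀ / 2, passifyingRel_zero_iff.2 ⟨?_, hPB⟩⟩
  rw [neg_lyapunov_closedLoop hPs A hPB]
  exact hk _ (by linarith)

end ClosedLoop

end

theorem mainTheorem3 (n : ℕ) (A : Matrix (Fin n) (Fin n) ℝ) (B C : Fin n → ℝ) (hB : B ≠ 0) :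
    -- a quadratic Lyapunov function and a gain exist if and only if `W` is hyper-minimum-phase
    ((∃ (P : Matrix (Fin n) (Fin n) ℝ) (K : ℝ), P.PosDef ∧
        ∀ e : Fin n → ℝ, e ≠ 0 → ∀ ξ : ℝ, ξ * (C ⬝ᵥ e) ≤ 0 → lyapunovDeriv A B C K P e ξ < 0) ↔
      IsHMP A B C) ∧
    -- every large enough gain works, and `0` can be replaced by `-μ P` (by `-μ V`) for small `μ`
    (IsHMP A B C →
      ∃ P : Matrix (Fin n) (Fin n) ℝ, P.PosDef ∧
        ∃ K₀ μ₀ : ℝ, 0 < μ₀ ∧ ∀ K : ℝ, K₀ ≤ K →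
          PassifyingRel A B C K 0 P ∧
          ∀ μ : ℝ, 0 < μ → μ ≤ μ₀ →
            PassifyingRel A B C K μ P ∧
            ∀ e : Fin n → ℝ, e ≠ 0 → ∀ ξ : ℝ, ξ * (C ⬝ᵥ e) ≤ 0 →
              lyapunovDeriv A B C K P e ξ < -μ * quadForm P e) ∧
    -- the replacement of `0` by `-μ P` is possible for every admissible pair `P`, `K`
    (∀ (P : Matrix (Fin n) (Fin n) ℝ) (K : ℝ), P.PosDef → PassifyingRel A B C K 0 P →
      ∃ μ₀ : ℝ, 0 < μ₀ ∧ ∀ μ : ℝ, 0 < μ → μ ≤ μ₀ → PassifyingRel A B C K μ P) := by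
  refine ⟨⟨?_, fun h => ?_⟩, fun h => ?_,
    fun P K hP h => h.exists_rate (posDef_iff_quadForm.1 hP).1⟩
  · rintro ⟨P, K, hP, h⟩
    obtain ⟨P', hP', h'⟩ := exists_passifyingRel_of_sector hB hP h
    exact isHMP_of_passifyingRel hB hP' h'
  · obtain ⟨P, hP, K, hK⟩ := exists_passifyingRel_of_isHMP h
    refine ⟨P, K, hP, fun e he ξ hξ => ?_⟩
    simpa using hK.lyapunovDeriv_lt (posDef_iff_quadForm.1 hP).1 he hξ
  · obtain ⟨P, hP, K₀, hK₀⟩ := exists_passifyingRel_of_isHMP h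
    have hPs := (posDef_iff_quadForm.1 hP).1
    obtain ⟨μ₀, hμ₀, hμ⟩ := hK₀.exists_rate hPs
    refine ⟨P, hP, K₀, μ₀, hμ₀, fun K hK => ⟨hK₀.mono_gain hPs hK, fun μ h₁ h₂ => ?_⟩⟩
    have hKμ := (hμ μ h₁ h₂).mono_gain hPs hK
    exact ⟨hKμ, fun e he ξ hξ => hKμ.lyapunovDeriv_lt hPs he hξ⟩
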